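/- Let $f\ge 0$ be a fixed integer. All graphs are finite, simple, undirected and unweighted, and faults are edge faults. There is a constant $C$ depending only on $f$ such that for every $n$-vertex graph $G=(V,E)$ and every $S\subseteq V$ there is an $(f+1)$-fault-tolerant $S\times S$ distance preserver of $G$ with at most $$C\, n^{2-1/2^f}\,|S|^{1/2^f}$$ edges, that is, a subgraph $H\subseteq G$ with $\mathrm{dist}_{H\setminus F}(s,t)=\mathrm{dist}_{G\setminus F}(s,t)$ for all $s,t\in S$ and all $F\subseteq E$ with $|F|\le f+1$. More precisely, a replacement path tiebreaking scheme (RPTS) of $G$ assigns to each $F\subseteq E$ and each ordered pair $s,t\in V$ one shortest $s\leadsto t$ path $\pi(s,t\mid F)$ in $G\setminus F$ (and $\emptyset$ if there is none). It is stable if $\pi(s,t\mid F\cup\{e\})=\pi(s,t\mid F)$ whenever $e\in E$ is not an edge of $\pi(s,t\mid F)$; consistent if, whenever $u$ precedes $v$ on $\pi(s,t\mid F)$, the path $\pi(u,v\mid F)$ is a contiguous subpath of $\pi(s,t\mid F)$; and restorable if for every nonempty $F\subseteq E$ and all $s,t$ connected in $G\setminus F$ there are $x\in V$ and $F'\subsetneq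 F$ such that $\pi(s,x\mid F')$ followed by the reverse of $\pi(t,x\mid F')$ is a shortest $s\leadsto t$ path in $G\setminus F$. Every graph $G$ has an RPTS that is stable, consistent and restorable; and for every such $\pi$, the union of all paths $\pi(s,v\mid F)$ with $s\in S$, $v\in V$, $F\subseteq E$, $|F|\le f$ is an $(f+1)$-fault-tolerant $S\times S$ distance preserver of $G$ with at most $C\,n^{2-1/2^f}|S|^{1/2^f}$ edges. -/

import Mathlib

namespace FaultTolerant

variable {V : Type*}

/-- `H` is an `S × T` `f`-(edge-)fault-tolerant distance preserver of `G`: it is a subgraph of `G`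
(on the same vertices) with `dist_{H ∖ F}(s, t) = dist_{G ∖ F}(s, t)` for all `s ∈ S`, `t ∈ T` and
all sets `F` of at most `f` edges of `G`. Distances are extended: `⊤` if `s`, `t` are disconnected. -/
def IsFTPreserver (G H : SimpleGraph V) (S T : Set V) (f : ℕ) : Prop :=
  H ≤ G ∧ ∀ s ∈ S, ∀ t ∈ T, ∀ F : Set (Sym2 V), F ⊆ G.edgeSet → F.encard ≤ f →
    (H.deleteEdges F).edist s t = (G.deleteEdges F).edist s t

/-- `p` is an `s ⇝ t` replacement path avoiding `F`, that is, a shortest `s ⇝ t` path of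
`G ∖ F`. (A walk whose length is the distance of its ends repeats no vertex.) -/
def IsReplacementPath {G : SimpleGraph V} {s t : V} (F : Set (Sym2 V)) (p : G.Walk s t) : Prop :=
  (∀ e ∈ p.edges, e ∉ F) ∧ (p.length : ℕ∞) = (G.deleteEdges F).edist s t

/-- A replacement path tiebreaking scheme: for every `F ⊆ E` and every ordered pair `(s, t)`, one
shortest `s ⇝ t` path `path s t F` of `G ∖ F`, or `none` if `G ∖ F` has no `s ⇝ t` path. -/
structure RPTS (G : SimpleGraph V) where
  path : (s t : V) → Set (Sym2 V) → Option (G.Walk s t)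
  isReplacementPath : ∀ s t F, F ⊆ G.edgeSet → ∀ p ∈ path s t F, IsReplacementPath F p
  exists_path : ∀ s t F, F ⊆ G.edgeSet → (G.deleteEdges F).Reachable s t →
    ∃ p, path s t F = some p

namespace RPTS

variable {G : SimpleGraph V}

/-- If `u` precedes `v` on `π(s, t | F)`, then `π(u, v | F)` is the part of it from `u` to `v`. -/
def Consistent (π : RPTS G) : Prop :=
  ∀ s t F, F ⊆ G.edgeSet → ∀ p ∈ π.path s t F,
    ∀ (u v : V) (q : G.Walk u v), q.IsSubwalk p → π.path u v F = some q

/-- If `e ∉ π(s, t | F)`, then `π(s, t | F ∪ {e}) = π(s, t | F)`. -/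
def Stable (π : RPTS G) : Prop :=
  ∀ s t F, F ⊆ G.edgeSet → ∀ e ∈ G.edgeSet, (∀ p ∈ π.path s t F, e ∉ p.edges) →
    π.path s t (insert e F) = π.path s t F

/-- For every nonempty fault set `F` and all `s`, `t` that are connected in `G ∖ F`, there are a
vertex `x` and `F' ⊊ F` such that `π(s, x | F')` followed by the reverse of `π(t, x | F')` is an
`s ⇝ t` replacement path avoiding `F`. -/
def Restorable (π : RPTS G) : Prop :=
  ∀ s t F, F ⊆ G.edgeSet → F.Nonempty → (G.deleteEdges F).Reachable s t →
    ∃ (x : V) (F' : Set (Sym2 V)), F' ⊂ F ∧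
      ∃ p ∈ π.path s x F', ∃ q ∈ π.path t x F', IsReplacementPath F (p.append q.reverse)

/-- The union of all the paths `π(s, v | F)` with `s ∈ S`, `v ∈ V`, `F ⊆ E`, `|F| ≤ f`. -/
def overlay (π : RPTS G) (S : Set V) (f : ℕ) : SimpleGraph V :=
  SimpleGraph.fromEdgeSet {e | ∃ s ∈ S, ∃ (v : V) (F : Set (Sym2 V)),
    F ⊆ G.edgeSet ∧ F.encard ≤ f ∧ ∃ p ∈ π.path s v F, e ∈ p.edges}

end RPTS

end FaultTolerant

/-!
Three facts make up the theorem: a scheme that is stable, consistent and restorable exists; the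
overlay of a restorable scheme is a preserver; the overlay of a stable and consistent scheme is
small.

*Existence.* Give every edge a weight of opposite signs in its two directions, such that distinct
paths with the same ends have distinct weights, and let `π(s, v | F)` be the replacement path of least
weight (`minWeightRPTS`). Uniqueness of the minimum gives stability and consistency. For
restorability, take `e ∈ F`, `F' = F ∖ {e}` and a shortest `s ⇝ t` path of `G ∖ F`, and let `xy` be a
step of it at which `π(s, · | F')` starts to use `e`. Then `π(t, x | F')` cannot use `e`: otherwise
`π(s, y | F')` and `π(t, x | F')` use `e` in opposite directions, both can be rerouted through `xy`
at equal length, and by antisymmetry the two inequalities of weights add up to `0 < 0`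
(`IsOptimal.not_of_adj`). So `x` and `F'` are as required (`minWeightRPTS_restorable`).

*Preserver.* Restorability writes a replacement path for `f + 1` faults as a concatenation of two
selected paths for at most `f` faults (`RPTS.Restorable.isFTPreserver_overlay`).

*Size.* By consistency every edge of the overlay is the last edge of a selected path, so it is
enough to bound, for each vertex `v`, the number `N(f, σ)` of last edges of the paths
`π(s, v | F)`, `s ∈ S`, `|S| = σ`, `|F| ≤ f`, by `O(n / y)`, where `y = (n / σ) ^ (1 / 2 ^ f)`
(`RPTS.exists_ncard_lastVerts_le`). By stability `F` may be built up so that each fault is an edge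
of the path that avoids the faults before it; then `F` is encoded by the positions of the faults,
counted from `v` (`RPTS.Stable.exists_faults`). Compare these positions, in decreasing order, with
thresholds `D 0, …, D (f - 1)`, where `D i` is about `y ^ 2 ^ (f - i - 1)`. If none exceeds its
threshold, there are at most `σ f! ∏ (D i + 1) = O(n / y)` choices (`RPTS.ncard_nearVerts_le`).
Otherwise `i + 1` of the faults are farther than `D i` from `v`, and these are irrelevant to paths to
`v` of length at most `D i` (`RPTS.avoids_faults`). A set `R` of at most `n / D i` vertices meets the
last `D i` vertices of a quarter of the paths in question (`exists_hitting_finset`), whose last edges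
are therefore among the last edges from the sources `R` for `f - i - 1` faults. By induction there
are at most `N(f - i - 1, n / D i) = O(n / y)` of those.
-/

namespace FaultTolerant

variable {V : Type*}

/-! ### Replacement paths -/

section ReplacementPath

variable {G : SimpleGraph V} {s t u v : V} {F F' : Set (Sym2 V)}

lemma edist_le_length {p : G.Walk s t} (hp : ∀ e ∈ p.edges, e ∉ F) :
    (G.deleteEdges F).edist s t ≤ p.length := by
  simpa using SimpleGraph.Walk.edist_le (p.toDeleteEdges F hp)

lemma reachable_of_avoids {p : G.Walk s t} (hp : ∀ e ∈ p.edges, e ∉ F) :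
    (G.deleteEdges F).Reachable s t :=
  ⟨p.toDeleteEdges F hp⟩

lemma exists_isReplacementPath (h : (G.deleteEdges F).Reachable s t) :
    ∃ p : G.Walk s t, IsReplacementPath F p := by
  obtain ⟨w, hw⟩ := h.exists_walk_length_eq_edist
  refine ⟨w.mapLe (G.deleteEdges_le F), fun e he => ?_, by simpa using hw⟩
  have := w.edges_subset_edgeSet (by simpa using he)
  rw [SimpleGraph.edgeSet_deleteEdges] at this
  exact this.2

namespace IsReplacementPath

lemma length_le {p q : G.Walk s t} (hp : IsReplacementPath F p) (hq : ∀ e ∈ q.edges, e ∉ F) :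
    p.length ≤ q.length := by
  exact_mod_cast hp.2.trans_le (edist_le_length hq)

/-- An `F`-avoiding walk no longer than some replacement path is a replacement path. -/
lemma of_length_le {p q : G.Walk s t} (hp : IsReplacementPath F p)
    (hq : ∀ e ∈ q.edges, e ∉ F) (h : q.length ≤ p.length) : IsReplacementPath F q :=
  ⟨hq, le_antisymm (hp.2 ▸ by exact_mod_cast h) (edist_le_length hq)⟩

lemma length_eq {p q : G.Walk s t} (hp : IsReplacementPath F p) (hq : IsReplacementPath F q) :
    p.length = q.length :=
  le_antisymm (hp.length_le hq.1) (hq.length_le hp.1)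

lemma reverse {p : G.Walk s t} (hp : IsReplacementPath F p) : IsReplacementPath F p.reverse := by
  refine ⟨by simpa using hp.1, ?_⟩
  rw [SimpleGraph.Walk.length_reverse, hp.2, SimpleGraph.edist_comm]

lemma of_isSubwalk {p : G.Walk s t} {q : G.Walk u v} (hp : IsReplacementPath F p)
    (hq : q.IsSubwalk p) : IsReplacementPath F q := by
  have hqF : ∀ e ∈ q.edges, e ∉ F := fun e he => hp.1 e (hq.edges_subset he)
  obtain ⟨r, hr⟩ := exists_isReplacementPath (reachable_of_avoids hqF)
  refine hr.of_length_le hqF ?_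
  obtain ⟨a, b, rfl⟩ := hq
  have := hp.length_le (q := (a.append r).append b) (by
    intro e he
    simp only [SimpleGraph.Walk.edges_append, List.mem_append] at he
    rcases he with (he | he) | he
    · exact hp.1 e (by simp [he])
    · exact hr.1 e he
    · exact hp.1 e (by simp [he]))
  simp only [SimpleGraph.Walk.length_append] at this
  omega

lemma isPath {p : G.Walk s t} (hp : IsReplacementPath F p) : p.IsPath := by
  rw [SimpleGraph.Walk.isPath_iff_isSubwalk_imp_nil]
  intro v w hw
  have := (hp.of_isSubwalk hw).2
  rw [SimpleGraph.edist_self] at this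
  exact SimpleGraph.Walk.length_eq_zero_iff.1 (by exact_mod_cast this)

lemma eq_nil {p : G.Walk s s} (hp : IsReplacementPath F p) : p = SimpleGraph.Walk.nil :=
  (SimpleGraph.Walk.isPath_iff_nil.1 hp.isPath).eq_nil

/-- A replacement path for `F` that also avoids a larger `F'` is a replacement path for `F'`. -/
lemma mono {p : G.Walk s t} (hp : IsReplacementPath F p) (hF : F ⊆ F')
    (hpF : ∀ e ∈ p.edges, e ∉ F') : IsReplacementPath F' p := by
  refine ⟨hpF, le_antisymm ?_ (edist_le_length hpF)⟩
  rw [hp.2]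
  exact SimpleGraph.edist_anti (G.deleteEdges_anti hF)

/-- Both ends of an edge of a replacement path to `v` are at least as far from `v` as the part of
the path that follows the edge is long. -/
lemma length_le_edist {a b z : V} {p : G.Walk s a} {h : G.Adj a b} {q : G.Walk b v}
    (hp : IsReplacementPath F (p.append (.cons h q))) (hz : z ∈ s(a, b)) :
    (q.length : ℕ∞) ≤ (G.deleteEdges F).edist z v := by
  have h₁ : IsReplacementPath F (SimpleGraph.Walk.cons h q) :=
    hp.of_isSubwalk (SimpleGraph.Walk.isSubwalk_of_append_right rfl)
  rcases Sym2.mem_iff.1 hz with rfl | rfl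
  · rw [← h₁.2, SimpleGraph.Walk.length_cons]
    exact_mod_cast Nat.le_succ _
  · exact (h₁.of_isSubwalk (SimpleGraph.Walk.isSubwalk_cons q h)).2.le

end IsReplacementPath

/-- Decompose a walk at an edge. -/
lemma exists_append_cons_of_mem_edges {e : Sym2 V} (p : G.Walk s t) (he : e ∈ p.edges) :
    ∃ (a b : V) (h : G.Adj a b) (p₁ : G.Walk s a) (p₂ : G.Walk b t),
      p = p₁.append (.cons h p₂) ∧ e = s(a, b) := by
  induction p with
  | nil => simp at he
  | @cons u v w h p ih =>
    rcases List.mem_cons.1 (SimpleGraph.Walk.edges_cons h p ▸ he) with rfl | he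
    · exact ⟨u, v, h, .nil, p, rfl, rfl⟩
    · obtain ⟨a, b, h', p₁, p₂, rfl, rfl⟩ := ih he
      exact ⟨a, b, h', .cons h p₁, p₂, rfl, rfl⟩

/-- If `P` holds at the start of a walk but not at its end, then some step of it leaves `P`. -/
lemma exists_append_cons_of_not (P : V → Prop) (p : G.Walk s t) (hs : P s) (ht : ¬ P t) :
    ∃ (a b : V) (h : G.Adj a b) (p₁ : G.Walk s a) (p₂ : G.Walk b t),
      p = p₁.append (.cons h p₂) ∧ P a ∧ ¬ P b := by
  induction p with
  | nil => exact absurd hs ht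
  | @cons u v w h p ih =>
    by_cases hv : P v
    · obtain ⟨a, b, h', p₁, p₂, rfl, h₁, h₂⟩ := ih hv ht
      exact ⟨a, b, h', .cons h p₁, p₂, rfl, h₁, h₂⟩
    · exact ⟨u, v, h, .nil, p, rfl, hs, hv⟩

/-- A vertex `b` that follows an edge `ab` on a shortest path from `s` is farther from `s` than `a`,
so shortest paths from `s` traverse an edge in one direction only. -/
lemma edist_lt_of_isReplacementPath_append {a b : V} {h : G.Adj a b} {p : G.Walk s a}
    {q : G.Walk b t} (hp : IsReplacementPath F (p.append (.cons h q))) :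
    (G.deleteEdges F).edist s a < (G.deleteEdges F).edist s b := by
  have h₁ : IsReplacementPath F p :=
    hp.of_isSubwalk (SimpleGraph.Walk.isSubwalk_of_append_left rfl)
  have h₂ : IsReplacementPath F (p.concat h) :=
    hp.of_isSubwalk (SimpleGraph.Walk.isSubwalk_of_append_left (p₂ := q) (by
      rw [SimpleGraph.Walk.concat_append]))
  rw [← h₁.2, ← h₂.2, SimpleGraph.Walk.length_concat]
  exact_mod_cast Nat.lt_succ_self _

/-- A path is determined by its ends and its set of darts. -/
lemma eq_of_mem_darts_iff {p q : G.Walk s t} (hp : p.IsPath) (hq : q.IsPath)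
    (h : ∀ d, d ∈ p.darts ↔ d ∈ q.darts) : p = q := by
  induction p with
  | nil => exact (SimpleGraph.Walk.isPath_iff_nil.1 hq).eq_nil.symm
  | @cons u v w a p ih =>
    cases q with
    | nil => exact absurd hp (by simp)
    | @cons _ v' _ b q =>
      have hp' := (SimpleGraph.Walk.cons_isPath_iff a p).1 hp
      have hq' := (SimpleGraph.Walk.cons_isPath_iff b q).1 hq
      have key : ∀ {x y z : V} (r : G.Walk x y) (d : G.Dart), z ∉ r.support → d ∈ r.darts →
          d.fst ≠ z := fun r d hz hd h' =>
        hz (h' ▸ SimpleGraph.Walk.dart_fst_mem_support_of_mem_darts r hd)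
      have hb := (h ⟨(u, v), a⟩).1 (by simp)
      rw [SimpleGraph.Walk.darts_cons, List.mem_cons] at hb
      obtain rfl : v = v' := by
        rcases hb with hb | hb
        · exact (Prod.ext_iff.1 (congrArg SimpleGraph.Dart.toProd hb)).2
        · exact absurd rfl (key q _ hq'.2 hb)
      congr 1
      refine ih hp'.1 hq'.1 fun d => ⟨fun hd => ?_, fun hd => ?_⟩
      · have := (h d).1 (by simp [hd])
        rw [SimpleGraph.Walk.darts_cons, List.mem_cons] at this
        exact this.resolve_left fun h' => key p d hp'.2 hd (by rw [h'])
      · have := (h d).2 (by simp [hd])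
        rw [SimpleGraph.Walk.darts_cons, List.mem_cons] at this
        exact this.resolve_left fun h' => key q d hq'.2 hd (by rw [h'])

end ReplacementPath

/-! ### Antisymmetric tiebreaking weights -/

section Weight

variable [Fintype V] {G : SimpleGraph V} {s t u v : V} {F : Set (Sym2 V)}

/-- The weight of the dart `(a, b)`: a formal generator indexed by `(a, b)` minus the one indexed by
`(b, a)`, in a free abelian group with the lexicographic order. Reversing a dart negates it. -/
noncomputable def dartWeight (a b : V) : Lex (Fin (Fintype.card (V × V)) → ℤ) :=
  toLex (Pi.single (Fintype.equivFin (V × V) (a, b)) 1 -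
    Pi.single (Fintype.equivFin (V × V) (b, a)) 1)

lemma dartWeight_swap (a b : V) : dartWeight b a = -dartWeight a b := by
  simp only [dartWeight, ← toLex_neg, neg_sub]

/-- The sum of the weights of the darts of a walk. -/
noncomputable def walkWeight (p : G.Walk s t) : Lex (Fin (Fintype.card (V × V)) → ℤ) :=
  (p.darts.map fun d => dartWeight d.fst d.snd).sum

@[simp] lemma walkWeight_nil : walkWeight (SimpleGraph.Walk.nil : G.Walk s s) = 0 := rfl

@[simp] lemma walkWeight_cons (h : G.Adj s u) (p : G.Walk u t) :
    walkWeight (SimpleGraph.Walk.cons h p) = dartWeight s u + walkWeight p := by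
  simp [walkWeight]

@[simp] lemma walkWeight_append (p : G.Walk s u) (q : G.Walk u t) :
    walkWeight (p.append q) = walkWeight p + walkWeight q := by
  simp [walkWeight]

lemma ofLex_dartWeight_apply [DecidableEq V] (a b : V) (x : V × V) :
    ofLex (dartWeight a b) (Fintype.equivFin (V × V) x) =
      (if x = (a, b) then 1 else 0) - (if x = (b, a) then 1 else 0) := by
  rw [dartWeight, ofLex_toLex, Pi.sub_apply, Pi.single_apply, Pi.single_apply]
  simp only [EmbeddingLike.apply_eq_iff_eq]

lemma ofLex_walkWeight_le_zero {p : G.Walk s t} {d : G.Dart} (hd : d ∉ p.darts) :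
    ofLex (walkWeight p) (Fintype.equivFin (V × V) d.toProd) ≤ 0 := by
  classical
  induction p with
  | nil => exact le_rfl
  | @cons u v w h p ih =>
    rw [SimpleGraph.Walk.darts_cons, List.mem_cons, not_or] at hd
    have hne : d.toProd ≠ (u, v) := fun h' => hd.1 (SimpleGraph.Dart.ext _ _ h')
    rw [walkWeight_cons, ofLex_add, Pi.add_apply, ofLex_dartWeight_apply, if_neg hne]
    have := ih hd.2
    split_ifs <;> omega

lemma ofLex_walkWeight_eq_one {p : G.Walk s t} (hp : p.IsPath) {d : G.Dart} (hd : d ∈ p.darts) :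
    ofLex (walkWeight p) (Fintype.equivFin (V × V) d.toProd) = 1 := by
  classical
  have aux : ∀ {s t : V} (p : G.Walk s t), d.edge ∉ p.edges →
      ofLex (walkWeight p) (Fintype.equivFin (V × V) d.toProd) = 0 := by
    intro s t p hp
    induction p with
    | nil => rfl
    | @cons u v w h p ih =>
      rw [SimpleGraph.Walk.edges_cons, List.mem_cons, not_or] at hp
      have h₁ : d.toProd ≠ (u, v) := fun h' => hp.1 (by simp [SimpleGraph.Dart.edge, h'])
      have h₂ : d.toProd ≠ (v, u) := fun h' => hp.1 (by
        simp [SimpleGraph.Dart.edge, h', Sym2.eq_swap])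
      rw [walkWeight_cons, ofLex_add, Pi.add_apply, ofLex_dartWeight_apply, if_neg h₁, if_neg h₂,
        ih hp.2]
      rfl
  induction p with
  | nil => simp at hd
  | @cons u v w h p ih =>
    have hnd := hp.isTrail.edges_nodup
    rw [SimpleGraph.Walk.edges_cons, List.nodup_cons] at hnd
    rw [SimpleGraph.Walk.darts_cons, List.mem_cons] at hd
    rw [walkWeight_cons, ofLex_add, Pi.add_apply, ofLex_dartWeight_apply]
    rcases hd with rfl | hd
    · have hne : (u, v) ≠ (v, u) := fun h' => h.ne (Prod.ext_iff.1 h').1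
      rw [aux p hnd.1, if_pos rfl, if_neg hne]
      rfl
    · have hde : d.edge ∈ p.edges := List.mem_map_of_mem hd
      have h₁ : d.toProd ≠ (u, v) := fun h' => hnd.1 (by
        rwa [SimpleGraph.Dart.edge, h'] at hde)
      have h₂ : d.toProd ≠ (v, u) := fun h' => hnd.1 (by
        rw [Sym2.eq_swap]; rwa [SimpleGraph.Dart.edge, h'] at hde)
      rw [if_neg h₁, if_neg h₂, ih (SimpleGraph.Walk.IsPath.of_cons hp) hd]
      rfl

/-- Distinct paths with the same ends have distinct weights: the darts of a path are the coordinates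
of its weight that are positive. -/
lemma eq_of_walkWeight_eq {p q : G.Walk s t} (hp : p.IsPath) (hq : q.IsPath)
    (h : walkWeight p = walkWeight q) : p = q := by
  refine eq_of_mem_darts_iff hp hq fun d => ⟨fun hd => ?_, fun hd => ?_⟩
  · by_contra hd'
    have h₁ := ofLex_walkWeight_eq_one hp hd
    have h₂ := ofLex_walkWeight_le_zero hd'
    rw [h] at h₁
    omega
  · by_contra hd'
    have h₁ := ofLex_walkWeight_eq_one hq hd
    have h₂ := ofLex_walkWeight_le_zero hd'
    rw [h] at h₂
    omega

/-- `p` is the replacement path avoiding `F` that has the least weight. -/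
def IsOptimal (F : Set (Sym2 V)) (p : G.Walk s t) : Prop :=
  IsReplacementPath F p ∧ ∀ q : G.Walk s t, IsReplacementPath F q → walkWeight p ≤ walkWeight q

lemma exists_isOptimal (h : (G.deleteEdges F).Reachable s t) :
    ∃ p : G.Walk s t, IsOptimal F p := by
  classical
  obtain ⟨p, hp⟩ := exists_isReplacementPath h
  have hfin : {q : G.Walk s t | IsReplacementPath F q}.Finite :=
    (G.finsetWalkLength p.length s t).finite_toSet.subset fun q hq =>
      (SimpleGraph.mem_finsetWalkLength_iff).2 (IsReplacementPath.length_eq hq hp)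
  obtain ⟨q, hq, hmin⟩ := hfin.exists_minimalFor walkWeight _ ⟨p, hp⟩
  exact ⟨q, hq, fun r hr => (le_total (walkWeight q) (walkWeight r)).elim id (hmin hr)⟩

namespace IsOptimal

lemma eq {p q : G.Walk s t} (hp : IsOptimal F p) (hq : IsReplacementPath F q)
    (h : walkWeight q ≤ walkWeight p) : p = q :=
  eq_of_walkWeight_eq hp.1.isPath hq.isPath (le_antisymm (hp.2 q hq) h)

lemma of_isSubwalk {p : G.Walk s t} {q : G.Walk u v} (hp : IsOptimal F p)
    (hq : q.IsSubwalk p) : IsOptimal F q := by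
  have hqR := hp.1.of_isSubwalk hq
  refine ⟨hqR, fun r hr => ?_⟩
  obtain ⟨a, b, rfl⟩ := hq
  have := hp.2 ((a.append r).append b) (hp.1.of_length_le (by
    intro e he
    simp only [SimpleGraph.Walk.edges_append, List.mem_append] at he
    rcases he with (he | he) | he
    · exact hp.1.1 e (by simp [he])
    · exact hr.1 e he
    · exact hp.1.1 e (by simp [he])) (by
    simp only [SimpleGraph.Walk.length_append, hr.length_eq hqR, le_refl]))
  simpa using this

end IsOptimal

end Weight

/-! ### Existence of a stable, consistent and restorable scheme -/

section Existence

variable [Fintype V] {G : SimpleGraph V} {s t : V} {F : Set (Sym2 V)}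

open Classical in
variable (G) in
/-- The scheme that selects the replacement path of least weight. -/
noncomputable def minWeightRPTS : RPTS G where
  path s t F := if h : ∃ p : G.Walk s t, IsOptimal F p then some h.choose else none
  isReplacementPath s t F _ p hp := by
    split_ifs at hp with h
    · obtain rfl := Option.some.inj hp
      exact h.choose_spec.1
    · simp at hp
  exists_path s t F _ h := by
    rw [dif_pos (exists_isOptimal h)]
    exact ⟨_, rfl⟩

lemma minWeightRPTS_path_eq_some {p : G.Walk s t} :
    (minWeightRPTS G).path s t F = some p ↔ IsOptimal F p := by
  constructor
  · intro hp
    simp only [minWeightRPTS] at hp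
    split_ifs at hp with h
    obtain rfl := Option.some.inj hp
    exact h.choose_spec
  · intro hp
    have h : ∃ p : G.Walk s t, IsOptimal F p := ⟨p, hp⟩
    simp only [minWeightRPTS, dif_pos h]
    exact congrArg some (h.choose_spec.eq hp.1 (hp.2 _ h.choose_spec.1))

lemma minWeightRPTS_stable : (minWeightRPTS G).Stable := by
  intro s t F _ e _ he
  by_cases h : ∃ p : G.Walk s t, IsOptimal F p
  · obtain ⟨p, hp⟩ := h
    have hpath := minWeightRPTS_path_eq_some.2 hp
    rw [hpath, minWeightRPTS_path_eq_some]
    have hpe : ∀ e' ∈ p.edges, e' ∉ insert e F := by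
      rintro e' he' (rfl | hF)
      · exact he p hpath he'
      · exact hp.1.1 e' he' hF
    have hp' := hp.1.mono (Set.subset_insert e F) hpe
    exact ⟨hp', fun q hq => hp.2 q (hp.1.of_length_le
      (fun e' he' hF => hq.1 e' he' (Set.mem_insert_of_mem _ hF)) (hq.length_eq hp').le)⟩
  · have h' : ¬ ∃ p : G.Walk s t, IsOptimal (insert e F) p := fun ⟨p, hp⟩ =>
      h (exists_isOptimal (reachable_of_avoids (p := p)
        fun e' he' hF => hp.1.1 e' he' (Set.mem_insert_of_mem _ hF)))
    simp only [minWeightRPTS, dif_neg h, dif_neg h']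

lemma minWeightRPTS_consistent : (minWeightRPTS G).Consistent := by
  intro s t F _ p hp u v q hq
  exact minWeightRPTS_path_eq_some.2 ((minWeightRPTS_path_eq_some.1 hp).of_isSubwalk hq)

/-- The exchange step: let `ab` start an optimal path `a, b ⇝ y` and its reverse an optimal path
`b, a ⇝ x`. If an edge `xy ≠ ab` survives, then `a ⇝ x, y` and `b ⇝ y, x` are competitors of the same
lengths. By antisymmetry the weights of the edges `ab` and `xy` cancel in the sum of the two
inequalities of optimality, so both are equalities, against the uniqueness of optimal paths. -/
lemma IsOptimal.not_of_adj {a b x y : V} (hab : G.Adj a b) (hxy : G.Adj x y)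
    {p : G.Walk b y} {q : G.Walk a x} (hp : IsOptimal F (.cons hab p))
    (hq : IsOptimal F (.cons hab.symm q)) (hF : s(x, y) ∉ F) (hne : s(x, y) ≠ s(a, b)) :
    False := by
  have hpF : ∀ e ∈ (p.concat hxy.symm).edges, e ∉ F := by
    intro e he
    simp only [SimpleGraph.Walk.edges_concat, List.concat_eq_append, List.mem_append,
      List.mem_singleton] at he
    rcases he with he | rfl
    · exact hp.1.1 e (by simp [he])
    · rwa [Sym2.eq_swap]
  have hqF : ∀ e ∈ (q.concat hxy).edges, e ∉ F := by
    intro e he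
    simp only [SimpleGraph.Walk.edges_concat, List.concat_eq_append, List.mem_append,
      List.mem_singleton] at he
    rcases he with he | rfl
    · exact hq.1.1 e (by simp [he])
    · exact hF
  have h₁ := hp.1.length_le hqF
  have h₂ := hq.1.length_le hpF
  simp only [SimpleGraph.Walk.length_cons, SimpleGraph.Walk.length_concat] at h₁ h₂
  have hp' := hq.1.of_length_le hpF (by simp; omega)
  have hq' := hp.1.of_length_le hqF (by simp; omega)
  have hle : walkWeight (q.concat hxy) ≤ walkWeight (SimpleGraph.Walk.cons hab p) := by
    have := hq.2 _ hp'
    simp only [SimpleGraph.Walk.concat_eq_append, walkWeight_append, walkWeight_cons,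
      walkWeight_nil, add_zero, dartWeight_swap x y, dartWeight_swap a b] at this ⊢
    rw [neg_add_le_iff_le_add, ← add_assoc, le_add_neg_iff_add_le] at this
    exact this
  have heq := hp.eq hq' hle
  have hmem : s(a, b) ∈ (q.concat hxy).edges := by rw [← heq]; simp
  simp only [SimpleGraph.Walk.edges_concat, List.concat_eq_append, List.mem_append,
      List.mem_singleton] at hmem
  have hnd := hq.1.isPath.isTrail.edges_nodup
  rw [SimpleGraph.Walk.edges_cons, List.nodup_cons, Sym2.eq_swap] at hnd
  exact hmem.elim hnd.1 fun h => hne h.symm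

lemma minWeightRPTS_restorable : (minWeightRPTS G).Restorable := by
  classical
  rintro s t F _ ⟨e, he⟩ hst
  have hsub : F \ {e} ⊂ F := Set.sdiff_singleton_ssubset.2 he
  obtain ⟨r, hr⟩ := exists_isReplacementPath hst
  -- It is enough to find optimal paths `s ⇝ x` and `t ⇝ x` avoiding `e`, with `x` on `r`.
  suffices h : ∃ (x : V) (r₁ : G.Walk s x) (r₂ : G.Walk x t), r = r₁.append r₂ ∧
      ∃ (p : G.Walk s x) (q : G.Walk t x), IsOptimal (F \ {e}) p ∧ IsOptimal (F \ {e}) q ∧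
        e ∉ p.edges ∧ e ∉ q.edges by
    obtain ⟨x, r₁, r₂, rfl, p, q, hp, hq, hpe, hqe⟩ := h
    refine ⟨x, F \ {e}, hsub, p, minWeightRPTS_path_eq_some.2 hp, q,
      minWeightRPTS_path_eq_some.2 hq, ?_⟩
    have hrF : ∀ e' ∈ (r₁.append r₂).edges, e' ∉ F \ {e} := fun e' h h' => hr.1 e' h h'.1
    have h₁ := hp.1.length_le (q := r₁) fun e' h => hrF e' (by simp [h])
    have h₂ := hq.1.length_le (q := r₂.reverse) fun e' h => hrF e' (by
      rw [SimpleGraph.Walk.edges_reverse, List.mem_reverse] at h; simp [h])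
    refine hr.of_length_le ?_ ?_
    · intro e' h hF
      rw [SimpleGraph.Walk.edges_append, List.mem_append, SimpleGraph.Walk.edges_reverse,
        List.mem_reverse] at h
      by_cases hee : e' = e
      · subst hee; exact h.elim hpe hqe
      · exact h.elim (fun h => hp.1.1 e' h ⟨hF, hee⟩) (fun h => hq.1.1 e' h ⟨hF, hee⟩)
    · simp only [SimpleGraph.Walk.length_append, SimpleGraph.Walk.length_reverse] at h₂ ⊢
      omega
  have hreach : ∀ {x y : V} (w : G.Walk x y), (∀ e' ∈ w.edges, e' ∉ F) →
      ∃ p : G.Walk x y, IsOptimal (F \ {e}) p := fun w hw =>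
    exists_isOptimal (reachable_of_avoids (p := w) fun e' h h' => hw e' h h'.1)
  by_cases ht : ∀ p : G.Walk s t, IsOptimal (F \ {e}) p → e ∉ p.edges
  · obtain ⟨p, hp⟩ := hreach r hr.1
    obtain ⟨q, hq⟩ := hreach (.nil : G.Walk t t) (by simp)
    refine ⟨t, r, .nil, by simp, p, q, hp, hq, ht p hp, ?_⟩
    rw [hq.1.eq_nil]
    simp
  obtain ⟨x, y, hxy, r₁, r₂, rfl, hx, hy⟩ := exists_append_cons_of_not
    (fun x => ∀ p : G.Walk s x, IsOptimal (F \ {e}) p → e ∉ p.edges) r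
    (fun p hp => by rw [hp.1.eq_nil]; simp) ht
  obtain ⟨p, hp⟩ := hreach r₁ fun e' h => hr.1 e' (by simp [h])
  obtain ⟨q, hq⟩ := hreach (SimpleGraph.Walk.cons hxy r₂).reverse fun e' h => hr.1 e' (by
    rw [SimpleGraph.Walk.edges_reverse, List.mem_reverse] at h
    rw [SimpleGraph.Walk.edges_append, List.mem_append]
    exact Or.inr h)
  refine ⟨x, r₁, _, rfl, p, q, hp, hq, hx p hp, fun hqe => ?_⟩
  push Not at ht hy
  obtain ⟨pt, hpt, hpte⟩ := ht
  obtain ⟨py, hpy, hpye⟩ := hy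
  obtain ⟨a, b, hab, A, B, rfl, rfl⟩ := exists_append_cons_of_mem_edges pt hpte
  obtain ⟨a', b', hab', A', B', rfl, he'⟩ := exists_append_cons_of_mem_edges py hpye
  obtain ⟨b'', a'', hab'', A'', B'', rfl, he''⟩ := exists_append_cons_of_mem_edges q hqe
  have d := edist_lt_of_isReplacementPath_append hpt.1
  have d' := edist_lt_of_isReplacementPath_append hpy.1
  have d'' := edist_lt_of_isReplacementPath_append hq.1
  have dt : ((G.deleteEdges (F \ {s(a, b)})).edist t b) <
      (G.deleteEdges (F \ {s(a, b)})).edist t a := by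
    have h := hpt.1.reverse
    rw [SimpleGraph.Walk.reverse_append, SimpleGraph.Walk.reverse_cons,
      ← SimpleGraph.Walk.append_assoc] at h
    exact edist_lt_of_isReplacementPath_append h
  -- The optimal paths from `s` run through `e` from `a` to `b`, and those from `t` from `b` to `a`.
  obtain ⟨rfl, rfl⟩ : a = a' ∧ b = b' := by
    rcases Sym2.eq_iff.1 he' with h | ⟨rfl, rfl⟩
    · exact h
    · exact absurd d d'.not_gt
  obtain ⟨rfl, rfl⟩ : a = a'' ∧ b = b'' := by
    rcases Sym2.eq_iff.1 he'' with ⟨rfl, rfl⟩ | h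
    · exact absurd dt d''.not_gt
    · exact h
  have hxyF : s(x, y) ∉ F := hr.1 _ (by simp)
  exact IsOptimal.not_of_adj hab hxy
    (hpy.of_isSubwalk (SimpleGraph.Walk.isSubwalk_of_append_right rfl))
    (hq.of_isSubwalk (SimpleGraph.Walk.isSubwalk_of_append_right rfl))
    (fun h => hxyF h.1) (fun h => hxyF (h ▸ he))

end Existence

/-! ### Two counting lemmas -/

section Counting

open Finset

/-- A hitting set without a logarithmic loss: among sets of size at least `D` in a universe of size
`n`, a quarter can be hit by a set of at most `n / D` points. -/
lemma exists_hitting_finset {ι α : Type*} [Fintype α] [DecidableEq α] (U : Finset ι)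
    (X : ι → Finset α) {D : ℕ} (hD : 0 < D) (hX : ∀ i ∈ U, D ≤ #(X i)) :
    ∃ R : Finset α, #R * D ≤ Fintype.card α ∧ #U ≤ 4 * #{i ∈ U | ∃ x ∈ R, x ∈ X i} := by
  classical
  set n := Fintype.card α with hn
  rcases U.eq_empty_or_nonempty with rfl | ⟨i₀, hi₀⟩
  · exact ⟨∅, by simp⟩
  have hDn : D ≤ n := (hX i₀ hi₀).trans (card_le_univ _)
  have hn0 : 0 < n := hD.trans_le hDn
  -- Greedily add a point that lies in the most sets not yet hit.
  have greedy : ∀ m : ℕ, ∃ R : Finset α, #R ≤ m ∧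
      (#U ≤ 2 * #{i ∈ U | ∃ x ∈ R, x ∈ X i} ∨
        m * (#U * D) ≤ 2 * n * #{i ∈ U | ∃ x ∈ R, x ∈ X i}) := by
    intro m
    induction m with
    | zero => exact ⟨∅, by simp⟩
    | succ m ih =>
      obtain ⟨R, hR, h | h⟩ := ih
      · exact ⟨R, by omega, Or.inl h⟩
      by_cases hhalf : #U ≤ 2 * #{i ∈ U | ∃ x ∈ R, x ∈ X i}
      · exact ⟨R, by omega, Or.inl hhalf⟩
      set W := {i ∈ U | ¬ ∃ x ∈ R, x ∈ X i} with hW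
      have hUW : #{i ∈ U | ∃ x ∈ R, x ∈ X i} + #W = #U :=
        card_filter_add_card_filter_not _
      obtain ⟨x, hx⟩ : ∃ x : α, #W * D ≤ n * #{i ∈ W | x ∈ X i} := by
        by_contra! hlt
        have hdc : ∑ x : α, #{i ∈ W | x ∈ X i} = ∑ i ∈ W, #(X i) := by
          have := sum_card_bipartiteAbove_eq_sum_card_bipartiteBelow
            (s := (univ : Finset α)) (t := W) (fun x i => x ∈ X i)
          simpa [bipartiteAbove, bipartiteBelow] using this
        have hge : #W * D ≤ ∑ i ∈ W, #(X i) := by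
          rw [← smul_eq_mul]
          exact card_nsmul_le_sum _ _ _ fun i hi => hX i (mem_filter.1 hi).1
        have : Nonempty α := Fintype.card_pos_iff.1 hn0
        have hs : ∑ x : α, n * #{i ∈ W | x ∈ X i} < ∑ _x : α, #W * D :=
          sum_lt_sum_of_nonempty univ_nonempty fun x _ => hlt x
        rw [← mul_sum, hdc, sum_const, smul_eq_mul, card_univ, ← hn] at hs
        exact absurd (Nat.lt_of_mul_lt_mul_left hs) hge.not_gt
      refine ⟨insert x R, (card_insert_le _ _).trans (by omega), Or.inr ?_⟩
      have hsub : #{i ∈ U | ∃ x ∈ R, x ∈ X i} + #{i ∈ W | x ∈ X i} ≤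
          #{i ∈ U | ∃ y ∈ insert x R, y ∈ X i} := by
        rw [← card_union_of_disjoint]
        · refine card_le_card fun i hi => ?_
          simp only [hW, mem_union, mem_filter, mem_insert] at hi ⊢
          rcases hi with ⟨h₁, y, hy, h₂⟩ | ⟨⟨h₁, -⟩, h₂⟩
          · exact ⟨h₁, y, Or.inr hy, h₂⟩
          · exact ⟨h₁, x, Or.inl rfl, h₂⟩
        · rw [disjoint_left]
          intro i h₁ h₂
          exact (mem_filter.1 (mem_filter.1 h₂).1).2 (mem_filter.1 h₁).2
      have h2W : #U * D ≤ 2 * (#W * D) := by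
        rw [← mul_assoc]
        exact Nat.mul_le_mul_right _ (by omega)
      have := Nat.mul_le_mul_left (2 * n) hsub
      rw [Nat.mul_add] at this
      rw [Nat.succ_mul]
      have h3 : 2 * (#W * D) ≤ 2 * n * #{i ∈ W | x ∈ X i} := by
        rw [mul_assoc]; exact Nat.mul_le_mul_left 2 hx
      omega
  obtain ⟨R, hR, h⟩ := greedy (n / D)
  refine ⟨R, (Nat.mul_le_mul_right D hR).trans (Nat.div_mul_le_self n D), ?_⟩
  rcases h with h | h
  · omega
  have hdiv : n ≤ 2 * (n / D * D) := by
    have h₁ := Nat.div_add_mod' n D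
    have h₂ := Nat.mod_lt n hD
    have h₃ : D ≤ n / D * D := Nat.le_mul_of_pos_left D (Nat.div_pos hDn hD)
    omega
  refine Nat.le_of_mul_le_mul_left (c := n) ?_ hn0
  calc n * #U ≤ 2 * (n / D * D) * #U := Nat.mul_le_mul_right _ hdiv
    _ = 2 * (n / D * (#U * D)) := by ring
    _ ≤ 2 * (2 * n * _) := Nat.mul_le_mul_left 2 h
    _ = n * (4 * _) := by ring

lemma countP_ofFn {α : Type*} {f : ℕ} (δ : Fin f → α) (P : α → Prop) [DecidablePred P] :
    (List.ofFn δ).countP (fun a => P a) = #{i | P (δ i)} := by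
  induction f with
  | zero => simp
  | succ f ih =>
    rw [List.ofFn_succ, List.countP_cons, ih, Fin.card_filter_univ_succ]
    by_cases h : P (δ 0) <;> simp [h]

lemma countP_lt_add_countP_le (D : ℕ) (l : List ℕ) :
    l.countP (D < ·) + l.countP (· ≤ D) = l.length := by
  induction l with
  | nil => rfl
  | cons m l ih =>
    simp only [List.countP_cons, List.length_cons, decide_eq_true_eq]
    split_ifs <;> omega

/-- If for each `i` at most `i` entries of `δ` exceed `D i`, then a permutation matches the entries
of `δ` with upper bounds among the `D i`: sort `δ` in decreasing order. -/
lemma exists_perm_le {f : ℕ} {δ D : Fin f → ℕ} (h : ∀ i, #{k | D i < δ k} ≤ (i : ℕ)) :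
    ∃ τ : Equiv.Perm (Fin f), ∀ k, δ k ≤ D (τ k) := by
  set σ := Tuple.sort (OrderDual.toDual ∘ δ)
  have hanti : Antitone (δ ∘ σ) := fun i j hij =>
    Tuple.monotone_sort (OrderDual.toDual ∘ δ) hij
  refine ⟨σ.symm, fun k => ?_⟩
  by_contra! hlt
  obtain ⟨i, rfl⟩ := σ.surjective k
  rw [Equiv.symm_apply_apply] at hlt
  have h₁ := (Tuple.lt_card_gt_iff_apply_gt_of_antitone (a := D i) hanti).2 hlt
  have h₂ : #{k | D i < (δ ∘ σ) k} = #{k | D i < δ k} :=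
    card_bij (fun k _ => σ k) (by simp) (fun _ _ _ _ hab => σ.injective hab) fun k hk =>
      ⟨σ.symm k, by simpa using hk, by simp⟩
  exact absurd (h i) (by omega)

/-- There are at most `f! ∏ (D i + 1)` lists of length `f` with, for each `i`, at most `i` entries
above `D i`. -/
lemma exists_finset_lists {f : ℕ} (D : Fin f → ℕ) :
    ∃ T : Finset (List ℕ), #T ≤ f.factorial * ∏ i, (D i + 1) ∧ ∀ l : List ℕ, l.length = f →
      (∀ i, l.countP (D i < ·) ≤ (i : ℕ)) → l ∈ T := by
  classical
  refine ⟨(univ : Finset (Equiv.Perm (Fin f))).biUnion fun τ =>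
    (Fintype.piFinset fun k => range (D (τ k) + 1)).image List.ofFn, ?_, ?_⟩
  · refine (card_biUnion_le_card_mul _ _ (∏ i, (D i + 1)) fun τ _ => ?_).trans ?_
    · refine card_image_le.trans ?_
      rw [Fintype.card_piFinset]
      simp only [card_range]
      exact (Equiv.prod_comp τ fun i => D i + 1).le
    · rw [card_univ, Fintype.card_perm, Fintype.card_fin]
  · rintro l rfl hl
    obtain ⟨τ, hτ⟩ := exists_perm_le (δ := l.get) (D := D) fun i => by
      have := countP_ofFn l.get (D i < ·)
      rw [List.ofFn_get] at this
      exact this ▸ hl i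
    simp only [mem_biUnion, mem_image, Fintype.mem_piFinset, mem_range]
    exact ⟨τ, mem_univ _, l.get, fun k => Nat.lt_succ_of_le (hτ k), List.ofFn_get l⟩

end Counting

/-! ### Fault sequences along replacement paths -/

namespace RPTS

variable {G : SimpleGraph V} {π : RPTS G} {s v x : V} {F F' : Set (Sym2 V)} {D : ℕ}

lemma Stable.path_eq_of_avoids [Finite V] (hπ : π.Stable) (hF : F' ⊆ G.edgeSet) (hFF : F ⊆ F')
    (h : ∀ p ∈ π.path s v F, ∀ e ∈ p.edges, e ∉ F') : π.path s v F' = π.path s v F := by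
  suffices ∀ A : Set (Sym2 V), A ⊆ F' → π.path s v (A ∪ F) = π.path s v F by
    simpa [Set.union_eq_self_of_subset_right hFF] using this F' subset_rfl
  intro A hA
  induction A, Set.toFinite A using Set.Finite.induction_on with
  | empty => simp
  | @insert e A _ _ ih =>
    rw [Set.insert_subset_iff] at hA
    have ih := ih hA.2
    rw [Set.insert_union, hπ s v _ (Set.union_subset hA.2 hFF |>.trans hF) e (hF hA.1), ih]
    intro p hp he
    rw [ih] at hp
    exact h p hp e he hA.1

variable (π s v) in
/-- The `m`-th edge of `π(s, v | F)`, counted from `v` with the last edge as number `1`, as a set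
with at most one element (none if `m = 0` or if the path is too short). -/
def edgeAt (F : Set (Sym2 V)) (m : ℕ) : Set (Sym2 V) :=
  {e | ∃ (a b : V) (h : G.Adj a b) (p : G.Walk s a) (q : G.Walk b v),
    p.append (.cons h q) ∈ π.path s v F ∧ q.length + 1 = m ∧ e = s(a, b)}

lemma edgeAt_subsingleton (m : ℕ) : (π.edgeAt s v F m).Subsingleton := by
  rintro e ⟨a, b, h, p, q, hp, rfl, rfl⟩ e' ⟨a', b', h', p', q', hp', hq, rfl⟩
  have hedges := congrArg SimpleGraph.Walk.edges (Option.some.inj (hp.symm.trans hp'))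
  simp only [SimpleGraph.Walk.edges_append, SimpleGraph.Walk.edges_cons] at hedges
  have := (List.append_inj' hedges (by simp; omega)).2
  exact (List.cons.inj this).1

lemma edgeAt_zero : π.edgeAt s v F 0 = ∅ := by
  ext e
  simp [edgeAt]

lemma edgeAt_subset (m : ℕ) : π.edgeAt s v F m ⊆ G.edgeSet := by
  rintro e ⟨a, b, h, -, -, -, -, rfl⟩
  exact h

variable (π s v) in
/-- The fault set encoded by a list of positions, the head being the last position: each fault is
the edge at the given position of the path `π(s, v | ·)` that avoids the faults before it. -/
def faults : List ℕ → Set (Sym2 V)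
  | [] => ∅
  | m :: l => faults l ∪ π.edgeAt s v (faults l) m

variable (π s v) in
/-- The part of `faults` that comes from positions at most `D`. -/
def nearFaults (D : ℕ) : List ℕ → Set (Sym2 V)
  | [] => ∅
  | m :: l => nearFaults D l ∪ {e | m ≤ D ∧ e ∈ π.edgeAt s v (π.faults s v l) m}

lemma faults_subset (l : List ℕ) : π.faults s v l ⊆ G.edgeSet := by
  induction l with
  | nil => exact Set.empty_subset _
  | cons m l ih => exact Set.union_subset ih (edgeAt_subset m)

lemma nearFaults_subset (l : List ℕ) : π.nearFaults s v D l ⊆ π.faults s v l := by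
  induction l with
  | nil => exact Set.empty_subset _
  | cons m l ih => exact Set.union_subset_union ih fun e he => he.2

lemma encard_nearFaults_le (l : List ℕ) :
    (π.nearFaults s v D l).encard ≤ (l.countP (· ≤ D) : ℕ) := by
  induction l with
  | nil => simp [nearFaults]
  | cons m l ih =>
    rw [nearFaults, List.countP_cons]
    refine (Set.encard_union_le _ _).trans ?_
    by_cases hm : m ≤ D
    · simp only [hm, true_and, Set.ofPred_mem_eq, decide_true, if_true, Nat.cast_add, Nat.cast_one]
      exact add_le_add ih (Set.encard_le_one_iff_subsingleton.2 (edgeAt_subsingleton m))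
    · simpa [hm] using ih

/-- A walk to `v` of length at most `D` that avoids the near faults avoids the far faults too, since
both ends of a far fault `e` are at distance at least `D` from `v` in the graph without the faults
before `e`. -/
lemma avoids_faults {l : List ℕ} {w : G.Walk x v} (hw : w.length ≤ D)
    (h : ∀ e ∈ w.edges, e ∉ π.nearFaults s v D l) : ∀ e ∈ w.edges, e ∉ π.faults s v l := by
  induction l with
  | nil => simp [faults]
  | cons m l ih =>
    have ih := ih fun e he h' => h e he (Or.inl h')
    rintro e he (he' | he')
    · exact ih e he he'
    · by_cases hm : m ≤ D
      · exact h e he (Or.inr ⟨hm, he'⟩)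
      obtain ⟨a, b, hab, p, q, hp, rfl, rfl⟩ := he'
      obtain ⟨a', b', h', w₁, w₂, rfl, hee⟩ := exists_append_cons_of_mem_edges w he
      have h₁ := (π.isReplacementPath s v _ (faults_subset l) _ hp).length_le_edist
        (z := b') (hee ▸ Sym2.mem_mk_right a' b')
      have h₂ := edist_le_length (p := w₂) fun e he => ih e (by simp [he])
      have h₃ : q.length ≤ w₂.length := by exact_mod_cast h₁.trans h₂
      simp only [SimpleGraph.Walk.length_append, SimpleGraph.Walk.length_cons] at hw
      omega

/-- Every fault set of size at most `f` may be replaced by one that is encoded by a list of `f`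
positions: pick a fault on the current path as long as there is one, and pad with zeros. -/
lemma Stable.exists_faults [Finite V] (hπ : π.Stable) (hF : F ⊆ G.edgeSet) {f : ℕ}
    (hf : F.encard ≤ f) {p : G.Walk s v} (hp : p ∈ π.path s v F) :
    ∃ l : List ℕ, l.length = f ∧ p ∈ π.path s v (π.faults s v l) ∧ ∀ m ∈ l, m ≤ p.length := by
  have hpR := π.isReplacementPath s v F hF p hp
  have key : ∀ k : ℕ, ∃ l : List ℕ, l.length = k ∧ π.faults s v l ⊆ F ∧
      (∀ m ∈ l, (m : ℕ∞) ≤ (G.deleteEdges (π.faults s v l)).edist s v) ∧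
      ((∀ p ∈ π.path s v (π.faults s v l), ∀ e ∈ p.edges, e ∉ F) ∨
        (k : ℕ∞) ≤ (π.faults s v l).encard) := by
    intro k
    induction k with
    | zero => exact ⟨[], rfl, Set.empty_subset _, by simp, Or.inr (by simp)⟩
    | succ k ih =>
      obtain ⟨l, hl, hlF, hm, h⟩ := ih
      by_cases hav : ∀ p ∈ π.path s v (π.faults s v l), ∀ e ∈ p.edges, e ∉ F
      · have h0 : π.faults s v (0 :: l) = π.faults s v l := by
          rw [faults, edgeAt_zero, Set.union_empty]
        exact ⟨0 :: l, by simp [hl], h0 ▸ hlF, by simpa [h0] using hm, Or.inl (by rwa [h0])⟩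
      have hk := h.resolve_left hav
      push Not at hav
      obtain ⟨r, hr, e, he, heF⟩ := hav
      obtain ⟨a, b, hab, r₁, r₂, rfl, rfl⟩ := exists_append_cons_of_mem_edges r he
      have hrR := π.isReplacementPath s v _ (faults_subset l) _ hr
      have hmem : s(a, b) ∈ π.edgeAt s v (π.faults s v l) (r₂.length + 1) :=
        ⟨a, b, hab, r₁, r₂, hr, rfl, rfl⟩
      have hins : π.faults s v ((r₂.length + 1) :: l) = insert s(a, b) (π.faults s v l) := by
        rw [faults, (edgeAt_subsingleton _).eq_singleton_of_mem hmem, Set.union_singleton]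
      have hmono : (G.deleteEdges (π.faults s v l)).edist s v ≤
          (G.deleteEdges (π.faults s v ((r₂.length + 1) :: l))).edist s v :=
        SimpleGraph.edist_anti (G.deleteEdges_anti (hins ▸ Set.subset_insert _ _))
      refine ⟨(r₂.length + 1) :: l, by simp [hl], hins ▸ Set.insert_subset heF hlF, ?_, Or.inr ?_⟩
      · intro m hm'
        refine le_trans ?_ hmono
        rcases List.mem_cons.1 hm' with rfl | hm'
        · rw [← hrR.2, SimpleGraph.Walk.length_append, SimpleGraph.Walk.length_cons]
          exact_mod_cast Nat.le_add_left _ _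
        · exact hm m hm'
      · rw [hins, Set.encard_insert_of_notMem (hrR.1 _ he)]
        exact_mod_cast add_le_add_left hk 1
  obtain ⟨l, hl, hlF, hm, h⟩ := key f
  have hav : ∀ p ∈ π.path s v (π.faults s v l), ∀ e ∈ p.edges, e ∉ F := by
    refine h.elim id fun h => ?_
    rw [(Set.toFinite _).eq_of_subset_of_encard_le hlF (hf.trans h)]
    exact fun p hp => (π.isReplacementPath s v F hF p hp).1
  have heq := hπ.path_eq_of_avoids hF hlF hav
  rw [heq] at hp
  refine ⟨l, hl, hp, fun m hml => ?_⟩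
  have := hm m hml
  rw [← (π.isReplacementPath s v _ (faults_subset l) p hp).2] at this
  exact_mod_cast this

/-! ### Counting the last edges of replacement paths -/

variable (π v) in
/-- The vertices `u` such that `uv` is the last edge of some `π(s, v | F)` with `s ∈ S`,
`|F| ≤ f`. -/
def lastVerts (S : Set V) (f : ℕ) : Set V :=
  {u | ∃ s ∈ S, ∃ F ⊆ G.edgeSet, F.encard ≤ f ∧
    ∃ (p : G.Walk s u) (h : G.Adj u v), p.concat h ∈ π.path s v F}

variable (π v) in
/-- The vertices `u` such that `uv` is the last edge of a path `π(s, v | F)` with `s ∈ S` and `F`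
encoded by a list of `f` positions on it of which, for each `i`, at most `i` are above `D i`. -/
def nearVerts (S : Set V) {f : ℕ} (D : Fin f → ℕ) : Set V :=
  {u | ∃ s ∈ S, ∃ l : List ℕ, l.length = f ∧ (∀ i, l.countP (D i < ·) ≤ (i : ℕ)) ∧
    ∃ (p : G.Walk s u) (h : G.Adj u v), p.concat h ∈ π.path s v (π.faults s v l)}

variable (π v) in
/-- The vertices `u` such that `uv` is the last edge of a path `π(s, v | F)` with `s ∈ S` and `F`
encoded by a list of `f` positions on it of which at least `j` are above `D`. -/
def farVerts (S : Set V) (f D j : ℕ) : Set V :=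
  {u | ∃ s ∈ S, ∃ l : List ℕ, l.length = f ∧ j ≤ l.countP (D < ·) ∧
    ∃ (p : G.Walk s u) (h : G.Adj u v), (∀ m ∈ l, m ≤ p.length + 1) ∧
      p.concat h ∈ π.path s v (π.faults s v l)}

lemma Stable.lastVerts_subset [Finite V] (hπ : π.Stable) (S : Set V) {f : ℕ} (D : Fin f → ℕ) :
    π.lastVerts v S f ⊆ π.nearVerts v S D ∪ ⋃ i : Fin f, π.farVerts v S f (D i) (i + 1) := by
  rintro u ⟨s, hs, F, hF, hf, p, h, hp⟩
  obtain ⟨l, hl, hpl, hm⟩ := hπ.exists_faults hF hf hp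
  by_cases hnear : ∀ i, l.countP (D i < ·) ≤ (i : ℕ)
  · exact Or.inl ⟨s, hs, l, hl, hnear, p, h, hpl⟩
  · push Not at hnear
    obtain ⟨i, hi⟩ := hnear
    exact Or.inr (Set.mem_iUnion.2 ⟨i, s, hs, l, hl, hi, p, h, by simpa using hm, hpl⟩)

/-- A near vertex is determined by the source and the list of positions. -/
lemma ncard_nearVerts_le (S : Finset V) {f : ℕ} (D : Fin f → ℕ) :
    (π.nearVerts v (S : Set V) D).ncard ≤ S.card * (f.factorial * ∏ i, (D i + 1)) := by
  classical
  obtain ⟨T, hT, hmem⟩ := exists_finset_lists D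
  have hsub : π.nearVerts v (S : Set V) D ⊆ ((S ×ˢ T).image fun x =>
      ((π.path x.1 v (π.faults x.1 v x.2)).elim v fun p => p.penultimate) : Finset V) := by
    rintro u ⟨s, hs, l, hl, hl', p, h, hp⟩
    rw [Finset.mem_coe, Finset.mem_image]
    refine ⟨(s, l), Finset.mem_product.2 ⟨hs, hmem l hl hl'⟩, ?_⟩
    rw [Option.mem_def] at hp
    simp [hp]
  calc _ ≤ _ := Set.ncard_le_ncard hsub (Finset.finite_toSet _)
    _ ≤ (S ×ˢ T).card := by rw [Set.ncard_coe_finset]; exact Finset.card_image_le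
    _ ≤ _ := by rw [Finset.card_product]; exact Nat.mul_le_mul_left _ hT

/-- Far faults are irrelevant near `v`: the last `D` vertices `x ≠ v` of a path with at least `j`
far faults reach `v` along it by replacement paths for at most `f - j` faults. A
hitting set of these ends thus accounts for a quarter of the far vertices. -/
lemma Stable.exists_ncard_farVerts_le [Fintype V] (hπ : π.Stable) (hc : π.Consistent) (S : Set V)
    {f j : ℕ} (hD : 0 < D) (hj : 0 < j) :
    ∃ R : Finset V, R.card * D ≤ Fintype.card V ∧
      (π.farVerts v S f D j).ncard ≤ 4 * (π.lastVerts v (R : Set V) (f - j)).ncard := by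
  classical
  have key : ∀ u ∈ π.farVerts v S f D j, ∃ X : Finset V, D ≤ X.card ∧
      ∀ R : Set V, ∀ x ∈ X, x ∈ R → u ∈ π.lastVerts v R (f - j) := by
    rintro u ⟨s, -, l, hl, hlj, p, h, hm, hp⟩
    have hR := π.isReplacementPath s v _ (faults_subset l) _ hp
    have hpp : p.IsPath :=
      (hR.of_isSubwalk (SimpleGraph.Walk.isSubwalk_concat p h)).isPath
    have hDp : D ≤ p.length := by
      obtain ⟨m, hml, hmD⟩ := List.countP_pos_iff.1 (hj.trans_le hlj)
      have := hm m hml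
      simp only [decide_eq_true_eq] at hmD
      omega
    refine ⟨(Finset.range D).image fun i => p.getVert (p.length - i), ?_, ?_⟩
    · rw [Finset.card_image_of_injOn, Finset.card_range]
      intro i hi i' hi' hii
      simp only [Finset.coe_range, Set.mem_Iio] at hi hi'
      have := hpp.getVert_injOn (by simp) (by simp) hii
      omega
    · intro R x hx hxR
      obtain ⟨i, hi, rfl⟩ := Finset.mem_image.1 hx
      rw [Finset.mem_range] at hi
      set q := (p.drop (p.length - i)).concat h with hq
      have hqs : q.IsSubwalk (p.concat h) := by
        refine SimpleGraph.Walk.isSubwalk_of_append_right (p₁ := p.take (p.length - i)) ?_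
        rw [hq, SimpleGraph.Walk.append_concat, SimpleGraph.Walk.append_take_drop_eq]
      have hqp := hc s v _ (faults_subset l) _ hp _ _ q hqs
      have hqR := hR.of_isSubwalk hqs
      have hNE := (nearFaults_subset (π := π) (s := s) (v := v) (D := D) l)
      have hqN : ∀ e ∈ q.edges, e ∉ π.nearFaults s v D l := fun e he h' => hqR.1 e he (hNE h')
      have hqD : q.length ≤ D := by
        rw [hq, SimpleGraph.Walk.length_concat, SimpleGraph.Walk.drop_length]
        omega
      refine ⟨_, hxR, π.nearFaults s v D l, hNE.trans (faults_subset l), ?_,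
        p.drop (p.length - i), h, ?_⟩
      · refine (encard_nearFaults_le l).trans ?_
        have := countP_lt_add_countP_le D l
        exact_mod_cast (show l.countP (· ≤ D) ≤ f - j by omega)
      · rw [Option.mem_def, ← hq, ← hqp]
        refine (hπ.path_eq_of_avoids (faults_subset l) hNE fun r hr => ?_).symm
        have hrR := π.isReplacementPath _ v _ (hNE.trans (faults_subset l)) r hr
        exact avoids_faults ((hrR.length_le hqN).trans hqD) hrR.1
  choose! X hX hXR using key
  obtain ⟨R, hRD, hU⟩ := exists_hitting_finset (π.farVerts v S f D j).toFinset X hD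
    fun u hu => hX u (Set.mem_toFinset.1 hu)
  refine ⟨R, hRD, ?_⟩
  rw [Set.ncard_eq_toFinset_card']
  refine hU.trans (Nat.mul_le_mul_left 4 ?_)
  rw [← Set.ncard_coe_finset]
  refine Set.ncard_le_ncard (fun u hu => ?_) (Set.toFinite _)
  obtain ⟨hu, x, hxR, hx⟩ := Finset.mem_filter.1 hu
  exact hXR u (Set.mem_toFinset.1 hu) _ x hx hxR

/-! ### The size of the overlay -/

section Size

open Finset

lemma sum_two_pow_add_one (f : ℕ) : ∑ i : Fin f, 2 ^ (f - (i + 1)) + 1 = 2 ^ f := by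
  rw [Fin.sum_univ_eq_sum_range fun i => 2 ^ (f - (i + 1))]
  have := sum_range_reflect (fun i => 2 ^ i) f
  simp only [Nat.sub_sub, Nat.add_comm 1] at this
  rw [this, Nat.geomSum_eq le_rfl]
  have := Nat.one_le_two_pow (n := f)
  omega

/-- The number of last edges at one vertex: if `y ^ 2 ^ f ≤ n / |S|` with `y ≥ 1`, then at most
`C n / y` edges at `v` end a replacement path from `S` to `v` for at most `f` faults. In terms of the
thresholds `D i ≈ y ^ 2 ^ (f - i - 1)`, the near vertices number `O(|S| ∏ D i) = O(n / y)`; with more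
than `i` faults above `D i`, the `n / D i` hitting points become the sources for `f - i - 1` faults. -/
theorem exists_ncard_lastVerts_le (f : ℕ) :
    ∃ C : ℝ, 0 ≤ C ∧ ∀ (V : Type*) [Fintype V] (G : SimpleGraph V) (π : RPTS G), π.Stable →
      π.Consistent → ∀ (v : V) (S : Finset V) (y : ℝ), 1 ≤ y →
        #S * y ^ 2 ^ f ≤ Fintype.card V →
          (π.lastVerts v (S : Set V) f).ncard * y ≤ C * Fintype.card V := by
  induction f using Nat.strong_induction_on with
  | _ f ih =>
  have hlt : ∀ i : Fin f, f - (i + 1) < f := fun i => by omega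
  choose C hC0 hC using fun i => ih _ (hlt i)
  refine ⟨f.factorial * 3 ^ f + ∑ i, 4 * C i, by
    have : ∀ i, 0 ≤ 4 * C i := fun i => mul_nonneg (by norm_num) (hC0 i)
    have := sum_nonneg fun i (_ : i ∈ (univ : Finset (Fin f))) => this i
    positivity, ?_⟩
  intro V _ G π hπ hc v S y hy hS
  set D : Fin f → ℕ := fun i => ⌈y ^ 2 ^ (f - (i + 1))⌉₊ with hDdef
  have hy0 : 0 < y := by linarith
  have hD1 : ∀ i : Fin f, y ^ 2 ^ (f - (i + 1)) ≤ D i := fun i => Nat.le_ceil _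
  have hD0 : ∀ i, 0 < D i := fun i => Nat.ceil_pos.2 (by positivity)
  have hD3 : ∀ i, ((D i + 1 : ℕ) : ℝ) ≤ 3 * y ^ 2 ^ (f - (i + 1)) := fun i => by
    have h₁ := (Nat.ceil_lt_add_one (a := y ^ 2 ^ (f - (i + 1))) (by positivity)).le
    have h₂ : (1 : ℝ) ≤ y ^ 2 ^ (f - (i + 1)) := one_le_pow₀ hy
    push_cast
    linarith
  have hnear : (π.nearVerts v (S : Set V) D).ncard * y ≤
      f.factorial * 3 ^ f * Fintype.card V := by
    have hprod : ((∏ i : Fin f, (D i + 1) : ℕ) : ℝ) * y ≤ 3 ^ f * y ^ 2 ^ f := by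
      rw [Nat.cast_prod]
      calc (∏ i, ((D i + 1 : ℕ) : ℝ)) * y
          ≤ (∏ i : Fin f, 3 * y ^ 2 ^ (f - (i + 1))) * y :=
            mul_le_mul_of_nonneg_right
              (prod_le_prod (fun i _ => Nat.cast_nonneg _) fun i _ => hD3 i) hy0.le
        _ = 3 ^ f * y ^ 2 ^ f := by
          rw [prod_mul_distrib, prod_const, card_univ, Fintype.card_fin, prod_pow_eq_pow_sum,
            mul_assoc, ← pow_succ, sum_two_pow_add_one]
    have h₁ : ((π.nearVerts v (S : Set V) D).ncard : ℝ) ≤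
        #S * (f.factorial * (∏ i : Fin f, (D i + 1) : ℕ)) := by
      exact_mod_cast ncard_nearVerts_le S D
    calc _ ≤ (#S * (f.factorial * (∏ i : Fin f, (D i + 1) : ℕ)) : ℝ) * y :=
          mul_le_mul_of_nonneg_right h₁ hy0.le
      _ = #S * f.factorial * ((∏ i : Fin f, (D i + 1) : ℕ) * y) := by ring
      _ ≤ #S * f.factorial * (3 ^ f * y ^ 2 ^ f) :=
          mul_le_mul_of_nonneg_left hprod (by positivity)
      _ = f.factorial * 3 ^ f * (#S * y ^ 2 ^ f) := by ring
      _ ≤ _ := mul_le_mul_of_nonneg_left hS (by positivity)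
  have hfar : ∀ i : Fin f, (π.farVerts v (S : Set V) f (D i) (i + 1)).ncard * y ≤
      4 * C i * Fintype.card V := fun i => by
    obtain ⟨R, hR, hle⟩ := hπ.exists_ncard_farVerts_le (v := v) hc (S : Set V) (f := f) (hD0 i)
      (Nat.succ_pos i)
    have h₁ := hC i V G π hπ hc v R y hy ((mul_le_mul_of_nonneg_left (hD1 i)
      (Nat.cast_nonneg _)).trans (by exact_mod_cast hR))
    have h₂ : ((π.farVerts v (S : Set V) f (D i) (i + 1)).ncard : ℝ) ≤
        4 * (π.lastVerts v (R : Set V) (f - (i + 1))).ncard := by exact_mod_cast hle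
    calc _ ≤ (4 * (π.lastVerts v (R : Set V) (f - (i + 1))).ncard : ℝ) * y :=
          mul_le_mul_of_nonneg_right h₂ hy0.le
      _ ≤ _ := by linarith
  have hunion : ((π.lastVerts v (S : Set V) f).ncard : ℝ) ≤
      (π.nearVerts v (S : Set V) D).ncard +
        ∑ i, ((π.farVerts v (S : Set V) f (D i) (i + 1)).ncard : ℝ) := by
    have h₁ := Set.ncard_le_ncard (hπ.lastVerts_subset (v := v) (S : Set V) D) (Set.toFinite _)
    have h₂ := Set.ncard_union_le (π.nearVerts v (S : Set V) D)
      (⋃ i : Fin f, π.farVerts v (S : Set V) f (D i) (i + 1))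
    have h₃ := Set.ncard_iUnion_le_of_fintype
      fun i : Fin f => π.farVerts v (S : Set V) f (D i) (i + 1)
    exact_mod_cast h₁.trans (h₂.trans (Nat.add_le_add_left h₃ _))
  calc _ ≤ _ := mul_le_mul_of_nonneg_right hunion hy0.le
    _ ≤ f.factorial * 3 ^ f * Fintype.card V + ∑ i, 4 * C i * Fintype.card V := by
      rw [add_mul, sum_mul]
      exact add_le_add hnear (sum_le_sum fun i _ => hfar i)
    _ = _ := by rw [add_mul, sum_mul]

/-- By consistency, every edge of the overlay is the last edge of a selected path. -/
lemma Consistent.overlay_edgeSet_subset (hc : π.Consistent) (S : Set V) (f : ℕ) :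
    (π.overlay S f).edgeSet ⊆ ⋃ v, (fun u => s(u, v)) '' π.lastVerts v S f := by
  intro e he
  rw [overlay, SimpleGraph.edgeSet_fromEdgeSet] at he
  obtain ⟨⟨s, hs, t, F, hF, hf, p, hp, hep⟩, -⟩ := he
  obtain ⟨a, b, h, p₁, p₂, rfl, rfl⟩ := exists_append_cons_of_mem_edges p hep
  exact Set.mem_iUnion.2 ⟨b, a, ⟨s, hs, F, hF, hf, p₁, h, hc s t F hF _ hp _ _ _
    (SimpleGraph.Walk.isSubwalk_of_append_left (p₂ := p₂)
      (by rw [SimpleGraph.Walk.concat_append]))⟩, rfl⟩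

theorem exists_ncard_overlay_le (f : ℕ) :
    ∃ C : ℝ, ∀ (V : Type*) [Fintype V] (G : SimpleGraph V) (S : Finset V) (π : RPTS G),
      π.Stable → π.Consistent → ((π.overlay (S : Set V) f).edgeSet.ncard : ℝ) ≤
        C * ((Fintype.card V : ℝ) ^ (2 - 1 / 2 ^ f : ℝ) * (#S : ℝ) ^ (1 / 2 ^ f : ℝ)) := by
  obtain ⟨C, -, hC⟩ := exists_ncard_lastVerts_le f
  refine ⟨C, fun V _ G S π hπ hc => ?_⟩
  rcases S.eq_empty_or_nonempty with rfl | hS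
  · have h0 : (π.overlay ((∅ : Finset V) : Set V) f).edgeSet = ∅ := by simp [overlay]
    rw [h0, Set.ncard_empty, card_empty, Nat.cast_zero, Real.zero_rpow (by positivity)]
    simp
  set n := Fintype.card V with hn
  have hσ : (0 : ℝ) < #S := by exact_mod_cast hS.card_pos
  have hσn : (#S : ℝ) ≤ n := by exact_mod_cast card_le_univ S
  have hn0 : (0 : ℝ) < n := hσ.trans_le hσn
  set y : ℝ := ((n : ℝ) / #S) ^ (1 / 2 ^ f : ℝ) with hydef
  have hy : 1 ≤ y := Real.one_le_rpow ((one_le_div hσ).2 hσn) (by positivity)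
  have hy0 : 0 < y := by linarith
  have hypow : y ^ 2 ^ f = n / #S := by
    rw [hydef, ← Real.rpow_natCast, ← Real.rpow_mul (by positivity)]
    push_cast
    rw [one_div_mul_cancel (by positivity), Real.rpow_one]
  have hv : ∀ v : V, ((π.lastVerts v (S : Set V) f).ncard : ℝ) ≤ C * n / y := fun v => by
    rw [le_div_iff₀ hy0]
    refine hC V G π hπ hc v S y hy ?_
    rw [hypow, mul_div_cancel₀ _ hσ.ne']
  have hsum : (π.overlay (S : Set V) f).edgeSet.ncard ≤
      ∑ v, (π.lastVerts v (S : Set V) f).ncard :=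
    (Set.ncard_le_ncard (hc.overlay_edgeSet_subset (S : Set V) f) (Set.toFinite _)).trans
      ((Set.ncard_iUnion_le_of_fintype _).trans
        (sum_le_sum fun v _ => Set.ncard_image_le (Set.toFinite _)))
  calc ((π.overlay (S : Set V) f).edgeSet.ncard : ℝ)
      ≤ ∑ v, ((π.lastVerts v (S : Set V) f).ncard : ℝ) := by exact_mod_cast hsum
    _ ≤ ∑ _v : V, C * n / y := sum_le_sum fun v _ => hv v
    _ = C * (n ^ 2 / y) := by
      rw [sum_const, card_univ, nsmul_eq_mul, ← hn]
      ring
    _ = _ := by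
      rw [hydef, Real.div_rpow hn0.le hσ.le, Real.rpow_sub hn0, Real.rpow_two]
      field_simp

end Size

/-! ### The overlay is a preserver -/

section Preserver

variable {S : Set V} {f : ℕ}

lemma overlay_le : π.overlay S f ≤ G := by
  rw [← SimpleGraph.edgeSet_subset_edgeSet, overlay, SimpleGraph.edgeSet_fromEdgeSet]
  rintro e ⟨⟨s, -, v, F, -, -, p, -, he⟩, -⟩
  exact p.edges_subset_edgeSet he

lemma mem_edgeSet_overlay {s v : V} {F : Set (Sym2 V)} {p : G.Walk s v} (hs : s ∈ S)
    (hF : F ⊆ G.edgeSet) (hf : F.encard ≤ f) (hp : p ∈ π.path s v F) {e : Sym2 V}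
    (he : e ∈ p.edges) : e ∈ (π.overlay S f).edgeSet := by
  rw [overlay, SimpleGraph.edgeSet_fromEdgeSet]
  exact ⟨⟨s, hs, v, F, hF, hf, p, hp, he⟩,
    fun h => G.not_isDiag_of_mem_edgeSet (p.edges_subset_edgeSet he) h⟩

/-- Restorability raises the number of faults by one: a replacement path for `f + 1` faults is the
concatenation of two selected paths for at most `f` faults. -/
theorem Restorable.isFTPreserver_overlay (hr : π.Restorable) :
    IsFTPreserver G (π.overlay S f) S S (f + 1) := by
  refine ⟨overlay_le, fun s hs t ht F hF hf => le_antisymm ?_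
    (SimpleGraph.edist_anti (SimpleGraph.deleteEdges_mono overlay_le))⟩
  by_cases hst : (G.deleteEdges F).Reachable s t
  swap
  · rw [SimpleGraph.edist_eq_top_of_not_reachable hst]
    exact le_top
  obtain ⟨p, hp, hpo⟩ : ∃ p : G.Walk s t, IsReplacementPath F p ∧
      ∀ e ∈ p.edges, e ∈ (π.overlay S f).edgeSet := by
    rcases F.eq_empty_or_nonempty with rfl | hne
    · obtain ⟨p, hp⟩ := π.exists_path s t ∅ hF hst
      exact ⟨p, π.isReplacementPath s t ∅ hF p hp,
        fun e he => mem_edgeSet_overlay hs hF (by simp) hp he⟩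
    · obtain ⟨x, F', hF', p, hp, q, hq, hpq⟩ := hr s t F hF hne hst
      have hfin : F.Finite := Set.finite_of_encard_le_coe hf
      have hf' : F'.encard ≤ f := by
        have := ((hfin.subset hF'.subset).encard_lt_encard hF').trans_le hf
        exact Order.le_of_lt_add_one (by exact_mod_cast this)
      refine ⟨_, hpq, fun e he => ?_⟩
      rw [SimpleGraph.Walk.edges_append, List.mem_append, SimpleGraph.Walk.edges_reverse,
        List.mem_reverse] at he
      exact he.elim (mem_edgeSet_overlay hs (hF'.subset.trans hF) hf' hp)
        (mem_edgeSet_overlay ht (hF'.subset.trans hF) hf' hq)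
  have := edist_le_length (F := F) (p := p.transfer (π.overlay S f) hpo) (by
    simpa using hp.1)
  rwa [SimpleGraph.Walk.length_transfer, hp.2] at this

end Preserver

end RPTS

end FaultTolerant

theorem mainTheorem2 (f : ℕ) :
    ∃ C : ℝ, ∀ (V : Type*) [Fintype V] (G : SimpleGraph V) (S : Finset V),
      (∃ H : SimpleGraph V,
        FaultTolerant.IsFTPreserver G H (S : Set V) (S : Set V) (f + 1) ∧
        (H.edgeSet.ncard : ℝ) ≤
          C * ((Fintype.card V : ℝ) ^ (2 - 1 / 2 ^ f : ℝ) * (S.card : ℝ) ^ (1 / 2 ^ f : ℝ))) ∧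
      (∃ π : FaultTolerant.RPTS G, π.Stable ∧ π.Consistent ∧ π.Restorable) ∧
      ∀ π : FaultTolerant.RPTS G, π.Stable → π.Consistent → π.Restorable →
        FaultTolerant.IsFTPreserver G (π.overlay (S : Set V) f) (S : Set V) (S : Set V) (f + 1) ∧
        ((π.overlay (S : Set V) f).edgeSet.ncard : ℝ) ≤
          C * ((Fintype.card V : ℝ) ^ (2 - 1 / 2 ^ f : ℝ) * (S.card : ℝ) ^ (1 / 2 ^ f : ℝ)) := by
  obtain ⟨C, hC⟩ := FaultTolerant.RPTS.exists_ncard_overlay_le f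
  refine ⟨C, fun V _ G S => ⟨?_, ?_, fun π hs hc hr =>
    ⟨hr.isFTPreserver_overlay, hC V G S π hs hc⟩⟩⟩
  · exact ⟨_, FaultTolerant.minWeightRPTS_restorable.isFTPreserver_overlay,
      hC V G S _ FaultTolerant.minWeightRPTS_stable FaultTolerant.minWeightRPTS_consistent⟩
  · exact ⟨FaultTolerant.minWeightRPTS G, FaultTolerant.minWeightRPTS_stable,
      FaultTolerant.minWeightRPTS_consistent, FaultTolerant.minWeightRPTS_restorable⟩
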